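/- Let $P$ be a Markov transition kernel on $\mathbb{R}^d$, let $(X_n)_{n\ge 0}$ be the time-homogeneous Markov chain with kernel $P$, and write $\mathbb{P}_\nu$ for its law on path space when $X_0\sim\nu$. Assume that the chain is positive Harris recurrent, that is: (a) there is a maximal irreducibility probability measure $\psi$ (the chain is $\psi$-irreducible, and $\varphi\ll\psi$ for every measure $\varphi$ for which it is $\varphi$-irreducible) such that for every measurable $C$ with $\psi(C)>0$ and every $x\in C$, $\mathbb{P}_x(X_n\in C \text{ for infinitely many } n)=1$; and (b) it admits a stationary probability measure. Let $\mu$ be its stationary probability measure, and let $A,B\subseteq\mathbb{R}^d$ be measurable with $\mu(A)\in(0,1)$. Let $S_{-1}:=0$ and $S_k:=\inf\{n>S_{k-1}: X_{n-1}\notin A,\ X_n\in A\}$ for $k\ge 0$ be the times of the inward crossings of $A$, and put $$L_k:=S_k-S_{k-1},\qquad R_k:=\sum_{n=S_{k-1}}^{S_k-1}\mathbf 1\{X_n\in B\},\qquad \alpha_A:=\mathbb{P}_\mu(X_0\notin A,\ X_1\in A).$$ Let $\mathbb{E}^{\circ}_\mu$ denote expectation in the cycle-stationary regime, i.e. under $\mathbb{P}_\mu(\,\cdot\mid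 S_0=1)$, where $\{S_0=1\}=\{X_0\notin A,\ X_1\in A\}$, and put $T_B:=\mathbb{E}^{\circ}_\mu R_1$. Then $\alpha_A>0$ (so that this conditional law is well defined), $\mathbb{E}^{\circ}_\mu L_1<\infty$, $$\mu(B)=\alpha_A\cdot T_B\qquad\text{and}\qquad \alpha_A=(\mathbb{E}^{\circ}_\mu L_1)^{-1}.$$ -/

import Mathlib

open MeasureTheory ProbabilityTheory Filter
open scoped ENNReal

noncomputable section

namespace RecurrencyCycles

variable {E : Type*} [MeasurableSpace E]

/-- The law `P_ν`, on the path space `ℕ → E`, of the time-homogeneous Markov chain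
`(X_n)_{n ≥ 0}` with transition kernel `P` and `X_0 ∼ ν`. The chain is the coordinate process:
`X_n ω = ω n`. -/
def pathLaw (P : Kernel E E) [IsMarkovKernel P] (ν : Measure E) : Measure (ℕ → E) :=
  Kernel.trajMeasure (X := fun _ => E) ν
    (fun n => P.comap (fun h : Finset.Iic n → E => h ⟨n, Finset.mem_Iic.2 le_rfl⟩)
      (measurable_pi_apply _))

/-- `ψ` is a maximal irreducibility probability measure: the chain is `ψ`-irreducible, and `ψ`
dominates every measure `φ` for which the chain is `φ`-irreducible. -/
structure IsMaximalIrreducibilityMeasure (P : Kernel E E) (ψ : Measure E) : Prop where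
  isProbabilityMeasure : IsProbabilityMeasure ψ
  irreducible : Kernel.IsIrreducible ψ P
  maximal : ∀ φ : Measure E, Kernel.IsIrreducible φ P → φ ≪ ψ

/-- The set `C` is Harris recurrent: from each of its points the chain almost surely
visits `C` infinitely often. -/
def IsHarrisRecurrentSet (P : Kernel E E) [IsMarkovKernel P] (C : Set E) : Prop :=
  ∀ x ∈ C, ∀ᵐ ω ∂(pathLaw P (Measure.dirac x)), ∃ᶠ n in atTop, ω n ∈ C

/-- The chain is Harris recurrent: it is `ψ`-irreducible, with `ψ` a maximal irreducibility
measure, and every measurable set of positive `ψ`-measure is Harris recurrent. -/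
def IsHarrisRecurrent (P : Kernel E E) [IsMarkovKernel P] : Prop :=
  ∃ ψ : Measure E, IsMaximalIrreducibilityMeasure P ψ ∧
    ∀ C : Set E, MeasurableSet C → 0 < ψ C → IsHarrisRecurrentSet P C

/-- The chain is positive Harris recurrent: it is Harris recurrent and admits a stationary
probability measure. -/
def IsPositiveHarrisRecurrent (P : Kernel E E) [IsMarkovKernel P] : Prop :=
  IsHarrisRecurrent P ∧ ∃ π : Measure E, IsProbabilityMeasure π ∧ Kernel.Invariant P π

/-- The first time `n > t` of an inward crossing of `A`, that is, with `ω (n - 1) ∉ A` and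
`ω n ∈ A`; it is `∞` if there is none. (Here `n = m + 1`.) -/
def nextCrossing (A : Set E) (ω : ℕ → E) (t : ℕ∞) : ℕ∞ :=
  ⨅ (m : ℕ) (_ : t < ((m + 1 : ℕ) : ℕ∞) ∧ ω m ∉ A ∧ ω (m + 1) ∈ A), ((m + 1 : ℕ) : ℕ∞)

/-- `crossingTime A ω k` is `S_{k-1}`, the time of the `k`-th inward crossing of `A` for `k ≥ 1`,
with `S_{-1} = 0`. -/
def crossingTime (A : Set E) (ω : ℕ → E) : ℕ → ℕ∞
  | 0 => 0
  | k + 1 => nextCrossing A ω (crossingTime A ω k)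

/-- The length `L_k = S_k - S_{k-1}` of the `k`-th recurrency cycle. -/
def cycleLength (A : Set E) (k : ℕ) (ω : ℕ → E) : ℕ∞ :=
  crossingTime A ω (k + 1) - crossingTime A ω k

open Classical in
/-- The total time `R_k = ∑_{n = S_{k-1}}^{S_k - 1} 1{X_n ∈ B}` spent in `B` within the `k`-th
recurrency cycle. -/
def timeSpent (A B : Set E) (k : ℕ) (ω : ℕ → E) : ℝ≥0∞ :=
  ∑' n : ℕ, if crossingTime A ω k ≤ n ∧ n < crossingTime A ω (k + 1) ∧ ω n ∈ B then 1 else 0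

/-- The law of the chain in the cycle-stationary regime: `X_0 ∼ μ`, conditionally on `S_0 = 1`. -/
def cycleStationaryLaw (P : Kernel E E) [IsMarkovKernel P] (μ : Measure E) (A : Set E) :
    Measure (ℕ → E) :=
  (pathLaw P μ)[|{ω | crossingTime A ω 1 = 1}]

/-- The expected length `E_μ L_1` of a recurrency cycle, in the cycle-stationary regime. -/
def meanCycleLength (P : Kernel E E) [IsMarkovKernel P] (μ : Measure E) (A : Set E) : ℝ≥0∞ :=
  ∫⁻ ω, (cycleLength A 1 ω : ℝ≥0∞) ∂(cycleStationaryLaw P μ A)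

/-- `T_B = E_μ R_1`, the expected time spent in `B` during a recurrency cycle, in the
cycle-stationary regime. -/
def meanTimeSpent (P : Kernel E E) [IsMarkovKernel P] (μ : Measure E) (A B : Set E) : ℝ≥0∞ :=
  ∫⁻ ω, timeSpent A B 1 ω ∂(cycleStationaryLaw P μ A)

/-- The frequency of recurrence `α_A = P_μ(X_0 ∉ A, X_1 ∈ A)`. -/
def recurrenceFrequency (P : Kernel E E) [IsMarkovKernel P] (μ : Measure E) (A : Set E) : ℝ≥0∞ :=
  pathLaw P μ {ω | ω 0 ∉ A ∧ ω 1 ∈ A}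

end RecurrencyCycles

end

/-! Let `D` be the set of paths with `X_0 ∉ A`, `X_1 ∈ A`. Started from `μ`, the path law is
invariant under the shift, and the times `1, …, S_1 - 1` of a path in `D` are the shifts up to and
including its first return to `D`. So the claim is Kac's formula (`measure_eq_tsum_of_ae_visit`): if
almost every path visits `D`, then `μ B` is the integral over `D` of `R_1`, which is `α_A * T_B`.
Taking `B` to be the whole space gives `1 = α_A * E L_1`, hence positivity and finiteness.

A path that never visits `D` stays in `A` forever or is eventually always outside `A`. Both events
are null by `pathLaw_forall_notMem_eq_zero`: the probability `G` of never visiting a set `C` with `μ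
C > 0` is subharmonic, hence `μ`-a.e. harmonic, so `{G = 0}` is a.e. absorbing. It is accessible
because it contains `C`, so it carries all of `μ`. -/

namespace RecurrencyCycles

/-! ### Kac's formula for a measure-preserving map -/

section Kac

variable {Ω : Type*} [MeasurableSpace Ω] {m : Measure Ω} {T : Ω → Ω} {D Q : Set Ω}

/-- The set of points that visit `Q` at time `n` without visiting `D` before. -/
def avoidThenVisit (T : Ω → Ω) (D Q : Set Ω) (n : ℕ) : Set Ω :=
  {ω | (∀ j < n, T^[j] ω ∉ D) ∧ T^[n] ω ∈ Q}

theorem measurableSet_avoidThenVisit (hT : Measurable T) (hD : MeasurableSet D)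
    (hQ : MeasurableSet Q) (n : ℕ) : MeasurableSet (avoidThenVisit T D Q n) := by
  have h : avoidThenVisit T D Q n = (⋂ j ∈ Finset.range n, T^[j] ⁻¹' Dᶜ) ∩ T^[n] ⁻¹' Q := by
    ext ω; simp [avoidThenVisit]
  rw [h]
  exact (Finset.measurableSet_biInter _ fun j _ => hT.iterate j hD.compl).inter (hT.iterate n hQ)

/-- Pull back along `T`, which preserves the measure, and split according to whether the starting
point lies in `D`. Iterating this telescopes. -/
theorem measure_avoidThenVisit_succ (hT : MeasurePreserving T m m) (hD : MeasurableSet D)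
    (hQ : MeasurableSet Q) (n : ℕ) :
    m (avoidThenVisit T D Q n) =
      m (D ∩ T ⁻¹' avoidThenVisit T D Q n) + m (avoidThenVisit T D Q (n + 1)) := by
  have hm := measurableSet_avoidThenVisit hT.measurable hD hQ n
  rw [← hT.measure_preimage hm.nullMeasurableSet, ← measure_inter_add_sdiff _ hD, Set.inter_comm]
  congr 2
  ext ω
  simp only [avoidThenVisit, Set.mem_sdiff, Set.mem_preimage, Set.mem_ofPred_eq,
    ← Function.iterate_succ_apply]
  constructor
  · rintro ⟨⟨h1, h2⟩, h3⟩
    refine ⟨fun j hj => ?_, h2⟩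
    cases j with
    | zero => exact h3
    | succ j => exact h1 j (by omega)
  · rintro ⟨h1, h2⟩
    exact ⟨⟨fun j hj => h1 (j + 1) (by omega), h2⟩, h1 0 (by omega)⟩

theorem measure_eq_sum_add (hT : MeasurePreserving T m m) (hD : MeasurableSet D)
    (hQ : MeasurableSet Q) (n : ℕ) :
    m Q = ∑ k ∈ Finset.range n, m (D ∩ T ⁻¹' avoidThenVisit T D Q k) +
      m (avoidThenVisit T D Q n) := by
  induction n with
  | zero => simp [avoidThenVisit]
  | succ n ih =>
    rw [ih, Finset.sum_range_succ, measure_avoidThenVisit_succ hT hD hQ n, add_assoc]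

/-- Kac's formula: if almost every point visits `D`, the measure of `Q` is the sum over `k` of the
measures of the set of points of `D` that visit `Q` at time `k + 1`, at or before the first return
to `D`. -/
theorem measure_eq_tsum_of_ae_visit [IsFiniteMeasure m] (hT : MeasurePreserving T m m)
    (hD : MeasurableSet D) (hQ : MeasurableSet Q) (h0 : m {ω | ∀ n, T^[n] ω ∉ D} = 0) :
    m Q = ∑' k, m (D ∩ T ⁻¹' avoidThenVisit T D Q k) := by
  have hlim : Tendsto (fun n => m (avoidThenVisit T D Q n)) atTop (nhds 0) := by
    have hmeas : ∀ n, MeasurableSet (avoidThenVisit T D Set.univ n) := fun n =>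
      measurableSet_avoidThenVisit hT.measurable hD .univ n
    have hanti : Antitone (avoidThenVisit T D Set.univ) := fun a b hab ω hω =>
      ⟨fun j hj => hω.1 j (by omega), trivial⟩
    have := tendsto_measure_iInter_atTop (μ := m) (fun n => (hmeas n).nullMeasurableSet) hanti
      ⟨0, measure_ne_top _ _⟩
    have hI : ⋂ n, avoidThenVisit T D Set.univ n = {ω | ∀ n, T^[n] ω ∉ D} := by
      ext ω
      simp only [avoidThenVisit, Set.mem_iInter, Set.mem_ofPred_eq]
      exact ⟨fun h n => (h (n + 1)).1 n (by omega), fun h n => ⟨fun j _ => h j, trivial⟩⟩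
    rw [hI, h0] at this
    exact tendsto_of_tendsto_of_tendsto_of_le_of_le tendsto_const_nhds this (fun _ => zero_le)
      fun n => measure_mono fun ω hω => ⟨hω.1, trivial⟩
  have h1 := (ENNReal.tendsto_nat_tsum
    fun k => m (D ∩ T ⁻¹' avoidThenVisit T D Q k)).add hlim
  simp only [add_zero] at h1
  refine tendsto_nhds_unique ?_ h1
  simp_rw [← measure_eq_sum_add hT hD hQ]
  exact tendsto_const_nhds

end Kac

section Shift

variable {E : Type*}

/-- The shift of the path space. -/
def shift (ω : ℕ → E) : ℕ → E := fun n => ω (n + 1)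

theorem shift_iterate (ω : ℕ → E) (j n : ℕ) : shift^[j] ω n = ω (n + j) := by
  induction j generalizing ω with
  | zero => rfl
  | succ j ih => rw [Function.iterate_succ_apply, ih]; simp only [shift]; congr 1

end Shift

/-! ### Markov property and stationarity on path space -/

section Path

variable {E : Type*} [MeasurableSpace E]

/-- The expectation of `f (X_n)` on the event that `X_i ∈ S i` for all `i < n`, as a function of the
starting point. -/
noncomputable def restrictedStep (P : Kernel E E) (S : ℕ → Set E) : ℕ → (E → ℝ≥0∞) → E → ℝ≥0∞
  | 0, f => f
  | n + 1, f => restrictedStep P S n ((S n).indicator fun x => ∫⁻ y, f y ∂P x)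

variable {P : Kernel E E} {S : ℕ → Set E} {f : E → ℝ≥0∞}

/-- The definition peels off the last transition; conditioning on the first one is what the shift
and the avoidance probabilities require. -/
theorem restrictedStep_succ' (n : ℕ) (f : E → ℝ≥0∞) :
    restrictedStep P S (n + 1) f =
      (S 0).indicator fun x => ∫⁻ y, restrictedStep P (fun i => S (i + 1)) n f y ∂P x := by
  induction n generalizing f with
  | zero => rfl
  | succ n ih => rw [restrictedStep, ih]; rfl

theorem measurable_restrictedStep (hS : ∀ i, MeasurableSet (S i)) (n : ℕ) (hf : Measurable f) :
    Measurable (restrictedStep P S n f) := by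
  induction n generalizing f with
  | zero => exact hf
  | succ n ih => exact ih (hf.lintegral_kernel.indicator (hS n))

variable [IsMarkovKernel P] {ν : Measure E}

instance [IsProbabilityMeasure ν] : IsProbabilityMeasure (pathLaw P ν) := by
  unfold pathLaw; infer_instance

theorem map_zero_pathLaw : (pathLaw P ν).map (fun ω => ω 0) = ν := by
  have h0 : (fun ω : ℕ → E => ω 0) =
      (MeasurableEquiv.piUnique fun _ : Finset.Iic 0 => E) ∘ Preorder.frestrictLe 0 := rfl
  rw [h0, ← Measure.map_map (by fun_prop) (by fun_prop), pathLaw, Kernel.trajMeasure,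
    Measure.map_comp _ _ (by fun_prop), Kernel.traj_map_frestrictLe, Kernel.partialTraj_self,
    Measure.id_comp, Measure.map_map (by fun_prop) (by fun_prop)]
  exact Measure.map_id

variable [IsProbabilityMeasure ν]

/-- The Markov property: the joint law of the past and `X_{n+1}` is the law of the past composed
with the kernel. -/
theorem lintegral_pathLaw_succ (n : ℕ) {g : (Finset.Iic n → E) → ℝ≥0∞} (hg : Measurable g)
    (hf : Measurable f) :
    ∫⁻ ω, g (fun i => ω i) * f (ω (n + 1)) ∂pathLaw P ν =
      ∫⁻ ω, g (fun i => ω i) * ∫⁻ y, f y ∂P (ω n) ∂pathLaw P ν := by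
  have h := Kernel.map_frestrictLe_trajMeasure_compProd_eq_map_trajMeasure (X := fun _ => E)
    (μ₀ := ν) (κ := fun n => P.comap (fun h : Finset.Iic n → E => h ⟨n, Finset.mem_Iic.2 le_rfl⟩)
      (measurable_pi_apply _)) (a := n)
  have hgf : Measurable fun p : (Finset.Iic n → E) × E => g p.1 * f p.2 := by fun_prop
  have h2 := congrArg
    (fun M : Measure ((Finset.Iic n → E) × E) => ∫⁻ p, g p.1 * f p.2 ∂M) h
  beta_reduce at h2
  rw [lintegral_map hgf (by fun_prop), Measure.lintegral_compProd hgf] at h2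
  simp_rw [lintegral_const_mul _ hf] at h2
  have hm : Measurable fun h : Finset.Iic n → E =>
      g h * ∫⁻ y, f y ∂P (h ⟨n, Finset.mem_Iic.2 le_rfl⟩) :=
    hg.mul (hf.lintegral_kernel.comp (measurable_pi_apply _))
  exact ((lintegral_map hm (by fun_prop)).symm.trans h2).symm

theorem measurableSet_forall_lt (hS : ∀ i, MeasurableSet (S i)) (n : ℕ) :
    MeasurableSet {ω : ℕ → E | ∀ i < n, ω i ∈ S i} := by
  have h : {ω : ℕ → E | ∀ i < n, ω i ∈ S i} = ⋂ i ∈ Finset.range n, (fun ω => ω i) ⁻¹' S i := by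
    ext; simp
  rw [h]
  exact Finset.measurableSet_biInter _ fun i _ => measurable_pi_apply i (hS i)

theorem setLIntegral_pathLaw (hS : ∀ i, MeasurableSet (S i)) (n : ℕ) (hf : Measurable f) :
    ∫⁻ ω in {ω | ∀ i < n, ω i ∈ S i}, f (ω n) ∂pathLaw P ν =
      ∫⁻ x, restrictedStep P S n f x ∂ν := by
  induction n generalizing f with
  | zero =>
    simp only [not_lt_zero, false_imp_iff, implies_true, Set.ofPred_true, Measure.restrict_univ,
      restrictedStep]
    conv_rhs => rw [← map_zero_pathLaw (P := P) (ν := ν), lintegral_map hf (by fun_prop)]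
  | succ n ih =>
    rw [restrictedStep, ← ih (hf.lintegral_kernel.indicator (hS n)),
      ← lintegral_indicator (measurableSet_forall_lt hS _),
      ← lintegral_indicator (measurableSet_forall_lt hS _)]
    have hm : MeasurableSet {h : Finset.Iic n → E | ∀ i : Finset.Iic n, h i ∈ S i} := by
      rw [Set.ofPred_forall]
      exact MeasurableSet.iInter fun i => measurable_pi_apply i (hS _)
    have key := lintegral_pathLaw_succ (P := P) (ν := ν) n
      (g := Set.indicator {h : Finset.Iic n → E | ∀ i : Finset.Iic n, h i ∈ S i} 1)
      (measurable_one.indicator hm) hf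
    have e : ∀ ω : ℕ → E, (fun i : Finset.Iic n => ω i) ∈ {h : Finset.Iic n → E | ∀ i : Finset.Iic n, h i ∈ S i} ↔
        ∀ i < n + 1, ω i ∈ S i := by
      intro ω
      simp
    refine Eq.trans (Eq.trans ?_ key) ?_
    · congr 1 with ω
      by_cases h : ∀ i < n + 1, ω i ∈ S i
      · rw [Set.indicator_of_mem ((e ω).2 h),
          Set.indicator_of_mem (show ω ∈ {ω : ℕ → E | ∀ i < n + 1, ω i ∈ S i} from h)]
        simp
      · rw [Set.indicator_of_notMem (mt (e ω).1 h), zero_mul]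
        exact Set.indicator_of_notMem (s := {ω : ℕ → E | ∀ i < n + 1, ω i ∈ S i}) h _
    · congr 1 with ω
      by_cases h : ∀ i < n + 1, ω i ∈ S i
      · have h1 : ω ∈ {ω : ℕ → E | ∀ i < n, ω i ∈ S i} := fun i hi => h i (by omega)
        rw [Set.indicator_of_mem ((e ω).2 h), Set.indicator_of_mem h1,
          Set.indicator_of_mem (h n (by omega))]
        simp
      · rw [Set.indicator_of_notMem (mt (e ω).1 h), zero_mul]
        by_cases h1 : ω ∈ {ω : ℕ → E | ∀ i < n, ω i ∈ S i}
        · rw [Set.indicator_of_mem h1, Set.indicator_of_notMem]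
          intro h2
          refine h fun i hi => ?_
          rcases Nat.lt_succ_iff_lt_or_eq.1 hi with hi | rfl
          exacts [h1 i hi, h2]
        · rw [Set.indicator_of_notMem h1]

theorem pathLaw_forall_lt (hS : ∀ i, MeasurableSet (S i)) (n : ℕ) :
    pathLaw P ν {ω | ∀ i < n, ω i ∈ S i} = ∫⁻ x, restrictedStep P S n 1 x ∂ν := by
  rw [← setLIntegral_pathLaw hS n measurable_one]
  simp

theorem measurable_shift : Measurable (shift : (ℕ → E) → ℕ → E) :=
  measurable_pi_lambda _ fun n => measurable_pi_apply (n + 1)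

theorem ext_of_forall_lt {m m' : Measure (ℕ → E)} [IsProbabilityMeasure m]
    [IsProbabilityMeasure m']
    (h : ∀ (S : ℕ → Set E) (n : ℕ), (∀ i, MeasurableSet (S i)) →
      m {ω | ∀ i < n, ω i ∈ S i} = m' {ω | ∀ i < n, ω i ∈ S i}) : m = m' := by
  refine ext_of_generate_finite _ generateFrom_squareCylinders.symm
    (isPiSystem_squareCylinders (fun _ => MeasurableSpace.isPiSystem_measurableSet) fun _ =>
      MeasurableSet.univ) ?_ (by simp)
  classical
  rintro _ ⟨s, t, ht, rfl⟩
  have h1 : ((s : Set ℕ).pi t) =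
      {ω : ℕ → E | ∀ i < s.sup id + 1, ω i ∈ if i ∈ s then t i else Set.univ} := by
    ext ω
    simp only [Set.mem_pi, Finset.mem_coe, Set.mem_ofPred_eq]
    refine ⟨fun h i _ => ?_, fun h i hi => ?_⟩
    · split_ifs with hi
      exacts [h i hi, trivial]
    · have := h i (Nat.lt_succ_of_le (Finset.le_sup (f := id) hi))
      rwa [if_pos hi] at this
  rw [h1]
  refine h (fun i => if i ∈ s then t i else Set.univ) _ fun i => ?_
  split_ifs
  exacts [ht i (Set.mem_univ i), .univ]

theorem measurePreserving_shift (hν : Kernel.Invariant P ν) :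
    MeasurePreserving shift (pathLaw P ν) (pathLaw P ν) := by
  refine ⟨measurable_shift, ?_⟩
  have : IsProbabilityMeasure ((pathLaw P ν).map shift) :=
    Measure.isProbabilityMeasure_map measurable_shift.aemeasurable
  refine ext_of_forall_lt fun S n hS => ?_
  rw [Measure.map_apply measurable_shift (measurableSet_forall_lt hS n), pathLaw_forall_lt hS]
  -- Prepending an unconstrained coordinate makes the shifted cylinder a cylinder again; its first
  -- transition is absorbed by invariance of `ν`.
  let S' : ℕ → Set E := fun i => Nat.casesOn i Set.univ S
  have hS' : ∀ i, MeasurableSet (S' i)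
    | 0 => .univ
    | i + 1 => hS i
  have h1 : shift ⁻¹' {ω : ℕ → E | ∀ i < n, ω i ∈ S i} = {ω | ∀ i < n + 1, ω i ∈ S' i} := by
    ext ω
    simp only [Set.mem_preimage, Set.mem_ofPred_eq]
    refine ⟨fun h i hi => ?_, fun h i hi => h (i + 1) (by omega)⟩
    cases i with
    | zero => trivial
    | succ i => exact h i (by omega)
  rw [h1, pathLaw_forall_lt hS', restrictedStep_succ']
  simp only [show S' 0 = Set.univ from rfl, Set.indicator_univ]
  rw [← Measure.lintegral_bind P.aemeasurable
    (measurable_restrictedStep hS n measurable_one).aemeasurable]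
  rw [hν.def]

end Path

/-! ### Sets of positive invariant measure are visited -/

section Accessible

variable {E : Type*} [MeasurableSpace E] {P : Kernel E E} {μ : Measure E}

theorem invariant_pow (hμ : Kernel.Invariant P μ) (n : ℕ) : Kernel.Invariant (P ^ n) μ := by
  induction n with
  | zero => exact Measure.id_comp
  | succ n ih => rw [pow_succ]; exact ih.comp hμ

theorem lintegral_pow_apply (hμ : Kernel.Invariant P μ) (n : ℕ) {C : Set E}
    (hC : MeasurableSet C) : ∫⁻ x, (P ^ n) x C ∂μ = μ C := by
  rw [← Measure.bind_apply hC (P ^ n).aemeasurable, (invariant_pow hμ n).def]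

theorem lintegral_lintegral_of_invariant (hμ : Kernel.Invariant P μ) {f : E → ℝ≥0∞}
    (hf : Measurable f) : ∫⁻ x, ∫⁻ y, f y ∂P x ∂μ = ∫⁻ x, f x ∂μ := by
  rw [← Measure.lintegral_bind P.aemeasurable hf.aemeasurable, hμ.def]

theorem pow_succ_apply (n : ℕ) (x : E) {C : Set E} (hC : MeasurableSet C) :
    (P ^ (n + 1)) x C = ∫⁻ y, (P ^ n) y C ∂P x := by
  rw [pow_succ]; exact Kernel.comp_apply' _ _ _ hC

instance isMarkovKernel_pow [IsMarkovKernel P] (n : ℕ) : IsMarkovKernel (P ^ n) := by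
  induction n with
  | zero => exact inferInstanceAs (IsMarkovKernel Kernel.id)
  | succ n ih => rw [pow_succ]; exact inferInstanceAs (IsMarkovKernel ((P ^ n) ∘ₖ P))

/-- If `Z` is almost surely absorbing and accessible from everywhere, then it carries the whole mass
of every finite invariant measure. -/
theorem measure_compl_eq_zero_of_absorbing [IsMarkovKernel P] [IsFiniteMeasure μ]
    (hμ : Kernel.Invariant P μ) {Z : Set E} (hZ : MeasurableSet Z)
    (habs : ∀ᵐ x ∂μ, x ∈ Z → P x Zᶜ = 0) (hacc : ∀ x, ∃ n, 0 < (P ^ n) x Z) :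
    μ Zᶜ = 0 := by
  have h1 : ∀ n, ∀ᵐ x ∂μ, x ∈ Z → (P ^ n) x Zᶜ = 0 := by
    intro n
    induction n with
    | zero =>
      refine ae_of_all _ fun x hx => ?_
      rw [pow_zero]
      change Kernel.id x Zᶜ = 0
      rw [Kernel.id_apply, Measure.dirac_apply' _ hZ.compl]
      simpa using hx
    | succ n ih =>
      have h2 : ∀ᵐ x ∂μ, ∀ᵐ y ∂P x, y ∈ Z → (P ^ n) y Zᶜ = 0 := by
        rw [← hμ.def] at ih
        exact Measure.ae_ae_of_ae_bind P.aemeasurable ih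
      filter_upwards [habs, h2] with x hx1 hx2 hx
      rw [pow_succ_apply n x hZ.compl, lintegral_eq_zero_iff ((P ^ n).measurable_coe hZ.compl)]
      have h3 : ∀ᵐ y ∂P x, y ∈ Z := hx1 hx
      filter_upwards [hx2, h3] with y hy1 hy2 using hy1 hy2
  have h4 : ∀ n, ∀ᵐ x ∂μ, x ∈ Zᶜ → (P ^ n) x Z = 0 := by
    intro n
    have hm := (P ^ n).measurable_coe hZ
    rw [← setLIntegral_eq_zero_iff hZ.compl hm]
    -- By absorption the points of `Z` already contribute `μ Z`, the full integral by invariance, so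
    -- nothing is left for `Zᶜ`.
    have h5 : ∫⁻ x in Z, (P ^ n) x Z ∂μ = μ Z := by
      rw [← setLIntegral_one]
      refine setLIntegral_congr_fun_ae hZ ?_
      filter_upwards [h1 n] with x hx hxZ
      exact (prob_compl_eq_zero_iff hZ).1 (hx hxZ)
    have h6 := lintegral_add_compl (μ := μ) (fun x => (P ^ n) x Z) hZ
    rw [lintegral_pow_apply hμ n hZ, h5] at h6
    exact (ENNReal.add_right_inj (measure_ne_top μ Z)).1 (h6.trans (add_zero _).symm)
  have h7 : ∀ᵐ x ∂μ, x ∈ Z := by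
    filter_upwards [ae_all_iff.2 h4] with x hx
    by_contra hxZ
    obtain ⟨n, hn⟩ := hacc x
    exact hn.ne' (hx n hxZ)
  exact h7

/-- For an irreducible kernel, sets of positive invariant measure are accessible from everywhere. -/
theorem exists_pow_apply_pos [IsMarkovKernel P] [IsFiniteMeasure μ] (hμ : Kernel.Invariant P μ)
    {ψ : Measure E} (hψ0 : ψ ≠ 0) (hψ : Kernel.IsIrreducible ψ P) {C : Set E}
    (hC : MeasurableSet C) (hμC : 0 < μ C) (x : E) : ∃ n, 0 < (P ^ n) x C := by
  -- The points that cannot reach `C` form an absorbing set. If it contains `x`, irreducibility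
  -- forces `ψ Nᶜ = 0`, so `N` is accessible and `μ Nᶜ = 0`; but `C ⊆ Nᶜ` (take `n = 0`).
  let N : Set E := ⋂ n, {y | (P ^ n) y C = 0}
  have hN : MeasurableSet N := MeasurableSet.iInter fun n =>
    (P ^ n).measurable_coe hC (measurableSet_singleton 0)
  have hmem : ∀ y, y ∈ N ↔ ∀ n, (P ^ n) y C = 0 := fun y => Set.mem_iInter
  by_contra hx
  push Not at hx
  have hxN : x ∈ N := (hmem x).2 fun n => le_antisymm (hx n) zero_le
  have habs : ∀ y ∈ N, P y Nᶜ = 0 := by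
    intro y hy
    have : ∀ᵐ z ∂P y, ∀ n, (P ^ n) z C = 0 := by
      refine ae_all_iff.2 fun n => ?_
      have := (hmem y).1 hy (n + 1)
      rw [pow_succ_apply n y hC, lintegral_eq_zero_iff ((P ^ n).measurable_coe hC)] at this
      exact this
    have h2 : ∀ᵐ z ∂P y, z ∈ N := this.mono fun z hz => (hmem z).2 hz
    exact h2
  have hpow : ∀ n, ∀ y ∈ N, (P ^ n) y Nᶜ = 0 := by
    intro n
    induction n with
    | zero =>
      intro y hy
      rw [pow_zero]
      change Kernel.id y Nᶜ = 0
      rw [Kernel.id_apply, Measure.dirac_apply' _ hN.compl]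
      simpa using hy
    | succ n ih =>
      intro y hy
      rw [pow_succ_apply n y hN.compl, lintegral_eq_zero_iff ((P ^ n).measurable_coe hN.compl)]
      have h3 : ∀ᵐ z ∂P y, z ∈ N := habs y hy
      exact h3.mono fun z hz => ih z hz
  have hψN : ψ Nᶜ = 0 := by
    by_contra h
    obtain ⟨n, hn⟩ := hψ.irreducible hN.compl (pos_iff_ne_zero.2 h) x
    exact hn.ne' (hpow n x hxN)
  have hψN' : 0 < ψ N := by
    rw [pos_iff_ne_zero]
    intro h
    refine hψ0 (Measure.measure_univ_eq_zero.1 ?_)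
    rw [← measure_add_measure_compl hN, h, hψN, add_zero]
  have h0 := measure_compl_eq_zero_of_absorbing hμ hN (ae_of_all _ habs)
    (hψ.irreducible hN hψN')
  refine hμC.ne' (measure_mono_null (t := Nᶜ) (fun y hy hyN => ?_) h0)
  have := (hmem y).1 hyN 0
  rw [pow_zero] at this
  change Kernel.id y C = 0 at this
  rw [Kernel.id_apply, Measure.dirac_apply' _ hC] at this
  simp [hy] at this

/-- A stationary irreducible chain almost surely does not stay forever in the complement of a set
of positive invariant measure. -/
theorem pathLaw_forall_notMem_eq_zero [IsMarkovKernel P] [IsProbabilityMeasure μ]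
    (hμ : Kernel.Invariant P μ) {ψ : Measure E} (hψ0 : ψ ≠ 0) (hψ : Kernel.IsIrreducible ψ P)
    {C : Set E} (hC : MeasurableSet C) (hμC : 0 < μ C) :
    pathLaw P μ {ω | ∀ n, ω n ∉ C} = 0 := by
  let g : ℕ → E → ℝ≥0∞ := fun n => restrictedStep P (fun _ => Cᶜ) n 1
  have hgm : ∀ n, Measurable (g n) := fun n =>
    measurable_restrictedStep (fun _ => hC.compl) n measurable_one
  have hg0 : g 0 = 1 := rfl
  have hgs : ∀ n, g (n + 1) = Cᶜ.indicator fun x => ∫⁻ y, g n y ∂P x := fun n =>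
    restrictedStep_succ' n 1
  have hanti : Antitone g := by
    refine antitone_nat_of_succ_le fun n => ?_
    induction n with
    | zero =>
      rw [hgs, hg0]
      refine Set.indicator_le' (fun x _ => ?_) fun x _ => zero_le
      simp
    | succ n ih =>
      refine (hgs (n + 1)).trans_le (le_trans ?_ (hgs n).ge)
      exact Set.indicator_mono fun x => lintegral_mono ih
  -- `g n x` is the probability from `x` of avoiding `C` at times `0, …, n - 1`; in the limit, `G x`
  -- is that of never visiting `C`.
  let G : E → ℝ≥0∞ := fun x => ⨅ n, g n x
  have hGm : Measurable G := Measurable.iInf hgm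
  have hG1 : ∀ x, G x ≤ 1 := fun x => iInf_le (fun n => g n x) 0
  have hlim : ∀ ν : Measure E, IsProbabilityMeasure ν →
      ∫⁻ x, G x ∂ν = ⨅ n, ∫⁻ x, g n x ∂ν := fun ν _ =>
    lintegral_iInf hgm hanti (by rw [hg0]; simp)
  have hGC : ∀ x ∈ C, G x = 0 := by
    intro x hx
    refine le_antisymm ((iInf_le (fun n => g n x) 1).trans ?_) zero_le
    change g (0 + 1) x ≤ 0
    rw [hgs]; simp [hx]
  have hGle : ∀ x, G x ≤ ∫⁻ y, G y ∂P x := by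
    intro x
    rw [hlim (P x) inferInstance]
    refine le_iInf fun n => (iInf_le (fun n => g n x) (n + 1)).trans ?_
    change g (n + 1) x ≤ _
    rw [hgs]
    exact Set.indicator_le_self' (fun _ _ => zero_le) x
  have hfin : ∫⁻ x, G x ∂μ ≠ ∞ :=
    ((lintegral_mono hG1).trans_lt (by simp)).ne
  -- By invariance both sides have the same finite integral, so the pointwise inequality is an a.e.
  -- equality.
  have hGeq : G =ᵐ[μ] fun x => ∫⁻ y, G y ∂P x :=
    ae_eq_of_ae_le_of_lintegral_le (ae_of_all _ hGle) hfin hGm.lintegral_kernel.aemeasurable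
      (lintegral_lintegral_of_invariant hμ hGm).le
  let Z : Set E := {x | G x = 0}
  have hZ : MeasurableSet Z := hGm (measurableSet_singleton 0)
  have h0 : μ Zᶜ = 0 := by
    refine measure_compl_eq_zero_of_absorbing hμ hZ ?_ fun x => ?_
    · filter_upwards [hGeq] with x hx hxZ
      have hxZ' : G x = 0 := hxZ
      rw [hxZ', eq_comm, lintegral_eq_zero_iff hGm] at hx
      exact hx
    · obtain ⟨n, hn⟩ := exists_pow_apply_pos hμ hψ0 hψ hC hμC x
      exact ⟨n, hn.trans_le (measure_mono hGC)⟩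
  have h1 : ∫⁻ x, G x ∂μ = 0 := by
    rw [lintegral_eq_zero_iff hGm]
    exact h0
  rw [hlim μ inferInstance] at h1
  refine le_antisymm ?_ zero_le
  rw [← h1]
  refine le_iInf fun n => ?_
  rw [← pathLaw_forall_lt (fun _ => hC.compl)]
  exact measure_mono fun ω hω i _ => hω i

end Accessible

/-! ### Crossing times as visits of the shifted path -/

section Crossing

variable {E : Type*} {A B : Set E}

/-- The set of the paths with an inward crossing of `A` at time `1`. -/
def crossingSet (A : Set E) : Set (ℕ → E) := {ω | ω 0 ∉ A ∧ ω 1 ∈ A}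

theorem shift_iterate_mem_crossingSet (ω : ℕ → E) (n : ℕ) :
    shift^[n] ω ∈ crossingSet A ↔ ω n ∉ A ∧ ω (n + 1) ∈ A := by
  simp only [crossingSet, Set.mem_ofPred_eq, shift_iterate, zero_add, add_comm 1 n]

theorem lt_nextCrossing_iff (ω : ℕ → E) (t : ℕ∞) (n : ℕ) :
    (n : ℕ∞) < nextCrossing A ω t ↔
      ∀ m : ℕ, t < ((m + 1 : ℕ) : ℕ∞) → shift^[m] ω ∈ crossingSet A → n ≤ m := by
  rw [← ENat.add_one_le_iff (ENat.natCast_ne_top n), nextCrossing]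
  simp only [le_iInf_iff, shift_iterate_mem_crossingSet, and_imp]
  refine forall_congr' fun m => forall_congr' fun _ => forall_congr' fun _ =>
    forall_congr' fun _ => ?_
  norm_cast
  omega

theorem crossingTime_one_eq_one_iff (ω : ℕ → E) :
    crossingTime A ω 1 = 1 ↔ ω ∈ crossingSet A := by
  have h0 : (0 : ℕ∞) < crossingTime A ω 1 :=
    (lt_nextCrossing_iff ω 0 0).2 fun _ _ _ => Nat.zero_le _
  have h1 : ((1 : ℕ) : ℕ∞) < crossingTime A ω 1 ↔ ω ∉ crossingSet A := by
    refine (lt_nextCrossing_iff ω 0 1).trans ⟨fun h hω => ?_, fun h m _ hm => ?_⟩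
    · simpa using h 0 (by simp) hω
    · by_contra hm'
      obtain rfl : m = 0 := by omega
      exact h hm
  rw [← not_iff_not, ← h1, Nat.cast_one]
  have h2 : (1 : ℕ∞) ≤ crossingTime A ω 1 := Order.one_le_iff_pos.2 h0
  exact ⟨fun h => lt_of_le_of_ne h2 (Ne.symm h), fun h => h.ne'⟩

theorem setOf_crossingTime_one_eq_one :
    {ω : ℕ → E | crossingTime A ω 1 = 1} = crossingSet A :=
  Set.ext fun ω => crossingTime_one_eq_one_iff ω

theorem lt_crossingTime_two_iff {ω : ℕ → E} (hω : ω ∈ crossingSet A) (k : ℕ) :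
    ((k + 1 : ℕ) : ℕ∞) < crossingTime A ω 2 ↔ ∀ j < k, shift^[j] (shift ω) ∉ crossingSet A := by
  have h : crossingTime A ω 2 = nextCrossing A ω 1 := by
    rw [← (crossingTime_one_eq_one_iff ω).2 hω]; rfl
  rw [h, lt_nextCrossing_iff]
  constructor
  · intro h j hj hmem
    have := h (j + 1) (by norm_cast; omega) hmem
    omega
  · intro h m hm hmem
    have hm' : 1 < m + 1 := by exact_mod_cast hm
    obtain ⟨j, rfl⟩ : ∃ j, m = j + 1 := ⟨m - 1, by omega⟩
    by_contra hlt
    exact h j (by omega) hmem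

theorem timeSpent_one_eq_tsum {ω : ℕ → E} (hω : ω ∈ crossingSet A) :
    timeSpent A B 1 ω = ∑' k, (shift ⁻¹' avoidThenVisit shift (crossingSet A)
      {ω | ω 0 ∈ B} k).indicator 1 ω := by
  rw [timeSpent, tsum_eq_zero_add' ENNReal.summable, (crossingTime_one_eq_one_iff ω).2 hω]
  simp only [Nat.cast_zero, nonpos_iff_eq_zero, one_ne_zero, false_and, if_false, zero_add]
  congr 1 with k
  have h : (1 ≤ ((k + 1 : ℕ) : ℕ∞) ∧ ((k + 1 : ℕ) : ℕ∞) < crossingTime A ω (1 + 1) ∧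
      ω (k + 1) ∈ B) ↔ ω ∈ shift ⁻¹' avoidThenVisit shift (crossingSet A) {ω | ω 0 ∈ B} k := by
    refine Iff.trans (and_iff_right (by simp)) (and_congr (lt_crossingTime_two_iff hω k) ?_)
    rw [Set.mem_ofPred_eq, shift_iterate, zero_add, shift]
  by_cases hk : ω ∈ shift ⁻¹' avoidThenVisit shift (crossingSet A) {ω | ω 0 ∈ B} k
  · rw [Set.indicator_of_mem hk]
    exact if_pos (h.2 hk)
  · rw [Set.indicator_of_notMem hk]
    exact if_neg (mt h.1 hk)

open Classical in
theorem tsum_ite_lt (a : ℕ∞) : ∑' k : ℕ, (if (k : ℕ∞) < a then 1 else 0 : ℝ≥0∞) = a := by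
  cases a with
  | top => simp
  | coe a =>
    rw [tsum_eq_sum (s := Finset.range a) fun k hk => if_neg (by simpa using hk),
      Finset.sum_congr rfl fun k hk => if_pos (by simpa using hk)]
    simp

theorem cycleLength_eq_timeSpent_univ (ω : ℕ → E) (hω : ω ∈ crossingSet A) :
    (cycleLength A 1 ω : ℝ≥0∞) = timeSpent A Set.univ 1 ω := by
  have h1 := (crossingTime_one_eq_one_iff ω).2 hω
  rw [cycleLength, timeSpent, tsum_eq_zero_add' ENNReal.summable, h1]
  simp only [Nat.cast_zero, nonpos_iff_eq_zero, one_ne_zero, false_and, if_false, zero_add]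
  have h2 : ∀ k : ℕ, ((1 : ℕ∞) ≤ ((k + 1 : ℕ) : ℕ∞) ∧ ((k + 1 : ℕ) : ℕ∞) < crossingTime A ω (1 + 1) ∧
      ω (k + 1) ∈ Set.univ) ↔ (k : ℕ∞) < crossingTime A ω 2 - 1 := by
    intro k
    -- If there is no second crossing, both the length and the time spent are infinite.
    cases crossingTime A ω 2 with
    | top => simp
    | coe a =>
      norm_cast
      simp
      omega
  simp only [h2]
  exact (tsum_ite_lt _).symm

/-- Once outside `A`, a path without inward crossings can never re-enter. -/
theorem exists_notMem_of_forall_notMem_crossingSet {ω : ℕ → E}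
    (h : ∀ n, shift^[n] ω ∉ crossingSet A) :
    (∀ n, ω n ∈ A) ∨ ∃ k, ∀ n, shift^[k] ω n ∉ A := by
  by_cases h0 : ∀ n, ω n ∈ A
  · exact Or.inl h0
  · push Not at h0
    obtain ⟨k, hk⟩ := h0
    refine Or.inr ⟨k, fun n => ?_⟩
    induction n with
    | zero => rwa [shift_iterate, zero_add]
    | succ n ih =>
      intro hmem
      refine h (n + k) ((shift_iterate_mem_crossingSet ω _).2 ⟨?_, ?_⟩)
      · rwa [shift_iterate] at ih
      · rwa [shift_iterate, add_right_comm] at hmem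

end Crossing

/-! ### The cycle formula -/

section Cycle

variable {E : Type*} [MeasurableSpace E] {P : Kernel E E} [IsMarkovKernel P]
  {μ : Measure E} {A B : Set E}

theorem measurableSet_crossingSet (hA : MeasurableSet A) : MeasurableSet (crossingSet A) :=
  (measurable_pi_apply (X := fun _ : ℕ => E) 0 hA.compl).inter
    (measurable_pi_apply (X := fun _ : ℕ => E) 1 hA)

theorem lintegral_cycleStationaryLaw (f : (ℕ → E) → ℝ≥0∞) :
    ∫⁻ ω, f ω ∂cycleStationaryLaw P μ A =
      (recurrenceFrequency P μ A)⁻¹ * ∫⁻ ω in crossingSet A, f ω ∂pathLaw P μ := by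
  rw [cycleStationaryLaw, setOf_crossingTime_one_eq_one, ProbabilityTheory.cond, lintegral_smul_measure]
  rfl

variable [IsProbabilityMeasure μ]

theorem setLIntegral_timeSpent (hμ : Kernel.Invariant P μ) (hA : MeasurableSet A)
    (hB : MeasurableSet B)
    (h0 : pathLaw P μ {ω | ∀ n, shift^[n] ω ∉ crossingSet A} = 0) :
    ∫⁻ ω in crossingSet A, timeSpent A B 1 ω ∂pathLaw P μ = μ B := by
  have hD := measurableSet_crossingSet hA
  have hQ : MeasurableSet {ω : ℕ → E | ω 0 ∈ B} := measurable_pi_apply 0 hB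
  have hm : ∀ k, MeasurableSet
      (shift ⁻¹' avoidThenVisit shift (crossingSet A) {ω : ℕ → E | ω 0 ∈ B} k) := fun k =>
    measurable_shift (measurableSet_avoidThenVisit measurable_shift hD hQ k)
  have h1 : pathLaw P μ {ω : ℕ → E | ω 0 ∈ B} = μ B := by
    conv_rhs => rw [← map_zero_pathLaw (P := P) (ν := μ),
      Measure.map_apply (measurable_pi_apply 0) hB]
    rfl
  rw [← h1, measure_eq_tsum_of_ae_visit (measurePreserving_shift hμ) hD hQ h0,
    setLIntegral_congr_fun hD fun ω hω => timeSpent_one_eq_tsum hω,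
    lintegral_tsum fun k => (measurable_one.indicator (hm k)).aemeasurable]
  congr 1 with k
  rw [lintegral_indicator_one (hm k), Measure.restrict_apply (hm k), Set.inter_comm]

theorem ae_exists_crossing (hμ : Kernel.Invariant P μ) {ψ : Measure E} (hψ0 : ψ ≠ 0)
    (hψ : Kernel.IsIrreducible ψ P) (hA : MeasurableSet A) (hA0 : 0 < μ A) (hA1 : μ A < 1) :
    pathLaw P μ {ω | ∀ n, shift^[n] ω ∉ crossingSet A} = 0 := by
  have hAc : 0 < μ Aᶜ := by
    rw [prob_compl_eq_one_sub hA]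
    exact tsub_pos_of_lt hA1
  have h1 := pathLaw_forall_notMem_eq_zero hμ hψ0 hψ hA.compl hAc
  have h2 := pathLaw_forall_notMem_eq_zero hμ hψ0 hψ hA hA0
  have h3 : ∀ k, pathLaw P μ (shift^[k] ⁻¹' {ω | ∀ n, ω n ∉ A}) = 0 := fun k =>
    ((measurePreserving_shift hμ).iterate k).quasiMeasurePreserving.preimage_null h2
  refine measure_mono_null (fun ω hω => ?_) (measure_union_null h1 (measure_iUnion_null h3))
  rcases exists_notMem_of_forall_notMem_crossingSet hω with h | ⟨k, h⟩
  · exact Or.inl fun n hn => hn (h n)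
  · exact Or.inr (Set.mem_iUnion.2 ⟨k, h⟩)

theorem cycle_formula (hμ : Kernel.Invariant P μ) {ψ : Measure E} (hψ0 : ψ ≠ 0)
    (hψ : Kernel.IsIrreducible ψ P) (hA : MeasurableSet A) (hB : MeasurableSet B)
    (hA0 : 0 < μ A) (hA1 : μ A < 1) :
    0 < recurrenceFrequency P μ A ∧ meanCycleLength P μ A < ∞ ∧
      μ B = recurrenceFrequency P μ A * meanTimeSpent P μ A B ∧
      recurrenceFrequency P μ A = (meanCycleLength P μ A)⁻¹ := by
  have h0 := ae_exists_crossing hμ hψ0 hψ hA hA0 hA1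
  have hD := measurableSet_crossingSet hA
  -- Otherwise the integral of `R_1` over a null set would equal `μ univ = 1`.
  have hpos : recurrenceFrequency P μ A ≠ 0 := by
    intro h
    have h1 := setLIntegral_timeSpent hμ hA .univ h0
    rw [Measure.restrict_eq_zero.2 (show pathLaw P μ (crossingSet A) = 0 from h)] at h1
    simp at h1
  have htop : recurrenceFrequency P μ A ≠ ∞ := measure_ne_top _ _
  have hL : meanCycleLength P μ A = (recurrenceFrequency P μ A)⁻¹ := by
    rw [meanCycleLength, lintegral_cycleStationaryLaw,
      setLIntegral_congr_fun hD fun ω hω => cycleLength_eq_timeSpent_univ ω hω,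
      setLIntegral_timeSpent hμ hA .univ h0, measure_univ, mul_one]
  refine ⟨pos_iff_ne_zero.2 hpos, ?_, ?_, ?_⟩
  · rw [hL]; exact ENNReal.inv_lt_top.2 (pos_iff_ne_zero.2 hpos)
  · rw [meanTimeSpent, lintegral_cycleStationaryLaw, setLIntegral_timeSpent hμ hA hB h0,
      ← mul_assoc, ENNReal.mul_inv_cancel hpos htop, one_mul]
  · rw [hL, inv_inv]

end Cycle

end RecurrencyCycles

theorem theorem1 (d : ℕ)
    (P : Kernel (EuclideanSpace ℝ (Fin d)) (EuclideanSpace ℝ (Fin d))) [IsMarkovKernel P]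
    (hP : RecurrencyCycles.IsPositiveHarrisRecurrent P)
    (μ : Measure (EuclideanSpace ℝ (Fin d))) [IsProbabilityMeasure μ]
    (hμ : Kernel.Invariant P μ)
    (A B : Set (EuclideanSpace ℝ (Fin d))) (hA : MeasurableSet A) (hB : MeasurableSet B)
    (hA0 : 0 < μ A) (hA1 : μ A < 1) :
    0 < RecurrencyCycles.recurrenceFrequency P μ A ∧
    RecurrencyCycles.meanCycleLength P μ A < ∞ ∧
    μ B = RecurrencyCycles.recurrenceFrequency P μ A * RecurrencyCycles.meanTimeSpent P μ A B ∧
    RecurrencyCycles.recurrenceFrequency P μ A = (RecurrencyCycles.meanCycleLength P μ A)⁻¹ := by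

  obtain ⟨⟨ψ, hψ, -⟩, -⟩ := hP
  have := hψ.isProbabilityMeasure
  exact RecurrencyCycles.cycle_formula hμ (IsProbabilityMeasure.ne_zero ψ) hψ.irreducible hA hB
    hA0 hA1
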